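/- An \emph{effect algebra} is a partial algebra $(E;\oplus,0,1)$ with a partial binary operation $\oplus$ such that: (E1) if $a\oplus b$ is defined, then $b\oplus a$ is defined and $a\oplus b=b\oplus a$; (E2) if $a\oplus b$ and $(a\oplus b)\oplus c$ are defined, then $b\oplus c$ and $a\oplus(b\oplus c)$ are defined and $(a\oplus b)\oplus c=a\oplus(b\oplus c)$; (E3) for every $a\in E$ there is a unique $a'\in E$ with $a\oplus a'=1$; (E4) if $a\oplus 1$ is defined, then $a=0$. Write $a\le b$ if $a\oplus c=b$ for some $c\in E$; this $c$ is then unique and is denoted $b\ominus a$. A finite family $(c_1,\dots,c_n)$ of (not necessarily distinct) elements of $E$ is \emph{orthogonal} if $c_1\oplus\dots\oplus c_n$ exists (the empty sum being $0$); its \emph{range} is $\{c_1,\dots,c_n\}$. A finite subset $M\subseteq E$ is \emph{compatible} if there is a finite orthogonal family $(c_1,\dots,c_n)$ in $E$ such that every $a\in M$ equals $\bigoplus_{i\in A}c_i$ for some $A\subseteq\{1,\dots,n\}$. An effect algebra $E$ is \emph{homogeneous} if for all $u,v_1,v_2\in E$ such that $v_1\oplus v_2$ is defined, $u\le v_1\oplus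 v_2$ and $u\le(v_1\oplus v_2)'$, there are $u_1\le v_1$ and $u_2\le v_2$ with $u=u_1\oplus u_2$. It satisfies the \emph{Riesz decomposition property} if for all $u,v_1,\dots,v_n\in E$ such that $v_1\oplus\dots\oplus v_n$ exists and $u\le v_1\oplus\dots\oplus v_n$, there are $u_1,\dots,u_n\in E$ with $u_i\le v_i$ for all $i$ and $u=u_1\oplus\dots\oplus u_n$. A \emph{sub-effect algebra} of $E$ is a subset $F\subseteq E$ with $1\in F$ such that $a\ominus b\in F$ whenever $a,b\in F$ and $b\le a$; it is an effect algebra under the restriction of $\oplus$, with the same $0$ and $1$. A \emph{block} of $E$ is a maximal (with respect to inclusion) element of the set of sub-effect algebras of $E$ that satisfy the Riesz decomposition property. \textbf{Corollary.} For an effect algebra $E$, the following are equivalent. (a) $E$ is homogeneous. (b) Every finite compatible subset of $E$ is contained in a block of $E$. (c) Every finite compatible subset of $E$ is contained in a sub-effect algebra of $E$ satisfying the Riesz decomposition property. (d) The range of every finite orthogonal family in $E$ is contained in a block of $E$. (e) The range of every finite orthogonal family in $E$ is contained in a sub-effect algebra of $E$ satisfying the Riesz decomposition property. (f) The range of every orthogonal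 family $(c_1,c_2,c_3)$ of length three in $E$ is contained in a block of $E$. (g) The range of every orthogonal family $(c_1,c_2,c_3)$ of length three in $E$ is contained in a sub-effect algebra of $E$ satisfying the Riesz decomposition property. -/

import Mathlib

universe u

/-- An effect algebra `(E; ⊕, 0, 1)`. The partial operation is modelled by an `Option`-valued
function: `oplus a b = some c` says that `a ⊕ b` is defined and equal to `c`. -/
class EffectAlgebra (E : Type u) extends Zero E, One E where
  oplus : E → E → Option E
  oplus_comm : ∀ a b c : E, oplus a b = some c → oplus b a = some c
  oplus_assoc : ∀ a b c d e : E, oplus a b = some d → oplus d c = some e →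
    ∃ f, oplus b c = some f ∧ oplus a f = some e
  exists_unique_compl : ∀ a : E, ∃! a' : E, oplus a a' = some 1
  eq_zero_of_oplus_one : ∀ a b : E, oplus a 1 = some b → a = 0

namespace EffectAlgebra

section Basic

variable {E : Type u} [EffectAlgebra E]

/-- The orthosupplement `a'`: the unique element with `a ⊕ a' = 1`. -/
noncomputable def compl (a : E) : E := (exists_unique_compl a).choose

theorem oplus_compl (a : E) : oplus a (compl a) = some 1 :=
  (exists_unique_compl a).choose_spec.1

theorem compl_unique {a b c : E} (hb : oplus a b = some 1) (hc : oplus a c = some 1) : b = c :=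
  (exists_unique_compl a).unique hb hc

/-- `a ≤ b` iff `a ⊕ c = b` for some `c`. -/
def Le (a b : E) : Prop := ∃ c : E, oplus a c = some b

theorem compl_one : compl (1 : E) = 0 :=
  eq_zero_of_oplus_one _ 1 (oplus_comm _ _ _ (oplus_compl 1))

theorem oplus_zero (a : E) : oplus a 0 = some a := by
  have h1 : oplus (1 : E) 0 = some 1 := by
    have h := oplus_compl (1 : E)
    rwa [compl_one] at h
  have h2 : oplus (compl a) a = some 1 := oplus_comm _ _ _ (oplus_compl a)
  obtain ⟨f, hf, hf'⟩ := oplus_assoc _ _ _ _ _ h2 h1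
  rw [hf, compl_unique hf' h2]

end Basic

/-- The values of sums that need not exist: `none` stands for an undefined sum. -/
def PartialValue (E : Type u) : Type u := Option E

section Sums

variable {E : Type u} [EffectAlgebra E]

/-- The extension of `⊕` to possibly undefined arguments: the sum is defined iff both
arguments are defined and their sum exists. -/
def PartialValue.add (x y : PartialValue E) : PartialValue E :=
  Option.bind x fun a => Option.bind y fun b => oplus a b

theorem PartialValue.add_eq_some {x y : PartialValue E} {c : E} :
    PartialValue.add x y = some c ↔ ∃ a b : E, x = some a ∧ y = some b ∧ oplus a b = some c := by
  unfold PartialValue.add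
  constructor
  · intro h
    obtain ⟨a, hx, h⟩ := Option.bind_eq_some_iff.1 h
    obtain ⟨b, hy, h⟩ := Option.bind_eq_some_iff.1 h
    exact ⟨a, b, hx, hy, h⟩
  · rintro ⟨a, b, rfl, rfl, h⟩
    exact h

theorem PartialValue.add_comm_aux (x y : PartialValue E) :
    PartialValue.add x y = PartialValue.add y x := by
  refine Option.ext fun c => ?_
  have key : ∀ x y : PartialValue E,
      PartialValue.add x y = some c → PartialValue.add y x = some c := by
    intro x y h
    obtain ⟨a, b, hx, hy, h⟩ := PartialValue.add_eq_some.1 h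
    exact PartialValue.add_eq_some.2 ⟨b, a, hy, hx, oplus_comm _ _ _ h⟩
  exact ⟨key x y, key y x⟩

theorem PartialValue.add_assoc_aux (x y z : PartialValue E) :
    PartialValue.add (PartialValue.add x y) z = PartialValue.add x (PartialValue.add y z) := by
  refine Option.ext fun e => ?_
  have key : ∀ x y z : PartialValue E,
      PartialValue.add (PartialValue.add x y) z = some e →
        PartialValue.add x (PartialValue.add y z) = some e := by
    intro x y z h
    obtain ⟨d, c, hxy, hz, h⟩ := PartialValue.add_eq_some.1 h
    obtain ⟨a, b, hx, hy, hab⟩ := PartialValue.add_eq_some.1 hxy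
    obtain ⟨f, hf, hf'⟩ := oplus_assoc _ _ _ _ _ hab h
    exact PartialValue.add_eq_some.2
      ⟨a, f, hx, PartialValue.add_eq_some.2 ⟨b, c, hy, hz, hf⟩, hf'⟩
  refine ⟨key x y z, fun h => ?_⟩
  rw [PartialValue.add_comm_aux x, PartialValue.add_comm_aux y] at h
  have h' := key z y x h
  rwa [PartialValue.add_comm_aux z, PartialValue.add_comm_aux y] at h'

theorem PartialValue.add_zero_aux (x : PartialValue E) :
    PartialValue.add x (some 0) = x := by
  match x with
  | none => rfl
  | some a => exact oplus_zero a

/-- Possibly undefined sums form a commutative monoid (`none` is absorbing), so that iterated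
sums are independent of order and bracketing; the empty sum is `0`. -/
instance instAddCommMonoidPartialValue : AddCommMonoid (PartialValue E) where
  add := PartialValue.add
  zero := (some 0 : Option E)
  add_assoc := PartialValue.add_assoc_aux
  zero_add x := (PartialValue.add_comm_aux _ x).trans (PartialValue.add_zero_aux x)
  add_zero := PartialValue.add_zero_aux
  add_comm := PartialValue.add_comm_aux
  nsmul := @nsmulRec _ ⟨(some 0 : Option E)⟩ ⟨PartialValue.add⟩

/-- An element of `E`, as a sum that is defined. -/
def toPartial (a : E) : PartialValue E := some a

/-- `HasOSum s c a`: the sum `⨁_{i ∈ s} c_i` exists and is equal to `a`. -/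
def HasOSum {ι : Type*} (s : Finset ι) (c : ι → E) (a : E) : Prop :=
  ∑ i ∈ s, toPartial (c i) = toPartial a

/-- A finite family `(c_1, …, c_n)` is orthogonal iff `c_1 ⊕ ⋯ ⊕ c_n` exists. -/
def IsOrthogonal {n : ℕ} (c : Fin n → E) : Prop :=
  ∃ a : E, HasOSum Finset.univ c a

/-- The finite set `F` is compatible with cover in `X`: some finite orthogonal family with
range in `X` has every element of `F` as the sum of a subfamily. -/
def FinsetCompatibleWithCoverIn (F : Finset E) (X : Set E) : Prop :=
  ∃ (n : ℕ) (c : Fin n → E), IsOrthogonal c ∧ Set.range c ⊆ X ∧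
    ∀ a ∈ F, ∃ A : Finset (Fin n), HasOSum A c a

/-- `M` is compatible with covers in `X`. -/
def CompatibleWithCoversIn (M X : Set E) : Prop :=
  ∀ F : Finset E, (F : Set E) ⊆ M → FinsetCompatibleWithCoverIn F X

/-- `M` is a compatible subset of `E`. -/
def IsCompatible (M : Set E) : Prop := CompatibleWithCoversIn M Set.univ

end Sums

/-- `E` is homogeneous. -/
def IsHomogeneous (E : Type u) [EffectAlgebra E] : Prop :=
  ∀ u v₁ v₂ w : E, oplus v₁ v₂ = some w → Le u w → Le u (compl w) →
    ∃ u₁ u₂ : E, Le u₁ v₁ ∧ Le u₂ v₂ ∧ oplus u₁ u₂ = some u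

/-- `E` satisfies the Riesz decomposition property. -/
def RieszDecomposition (E : Type u) [EffectAlgebra E] : Prop :=
  ∀ (n : ℕ) (v : Fin n → E) (w u : E), HasOSum Finset.univ v w → Le u w →
    ∃ t : Fin n → E, (∀ i, Le (t i) (v i)) ∧ HasOSum Finset.univ t u

end EffectAlgebra

open EffectAlgebra in
/-- A sub-effect algebra of `E`: a subset that contains `1` and is closed under
`a ⊖ b` for `b ≤ a`, where `a ⊖ b = c` means `b ⊕ c = a`. -/
structure SubEffectAlgebra (E : Type u) [EffectAlgebra E] where
  carrier : Set E
  one_mem : (1 : E) ∈ carrier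
  ominus_mem : ∀ a b c : E, a ∈ carrier → b ∈ carrier → oplus b c = some a → c ∈ carrier

namespace SubEffectAlgebra

open EffectAlgebra

variable {E : Type u} [EffectAlgebra E]

instance instSetLike : SetLike (SubEffectAlgebra E) E where
  coe := carrier
  coe_injective := by
    rintro ⟨S, _, _⟩ ⟨T, _, _⟩ h
    congr

/-- Sub-effect algebras are ordered by inclusion. -/
instance instPartialOrder : PartialOrder (SubEffectAlgebra E) := PartialOrder.ofSetLike _ _

theorem zero_mem (S : SubEffectAlgebra E) : (0 : E) ∈ S :=
  S.ominus_mem 1 1 0 S.one_mem S.one_mem (oplus_zero 1)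

theorem oplus_mem (S : SubEffectAlgebra E) {a b c : E} (ha : a ∈ S) (hb : b ∈ S)
    (h : oplus a b = some c) : c ∈ S := by
  obtain ⟨f, hf, hf'⟩ := oplus_assoc _ _ _ _ _ h (oplus_compl c)
  have h1 : f ∈ S := S.ominus_mem 1 a f S.one_mem ha hf'
  have h2 : compl c ∈ S := S.ominus_mem f b _ h1 hb hf
  exact S.ominus_mem 1 (compl c) c S.one_mem h2 (oplus_comm _ _ _ (oplus_compl c))

/-- The restriction of `⊕` to a sub-effect algebra. -/
def restrict (S : SubEffectAlgebra E) (a b : S) : Option S :=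
  match h : oplus (a : E) (b : E) with
  | none => none
  | some c => some ⟨c, S.oplus_mem a.2 b.2 h⟩

theorem restrict_eq_some (S : SubEffectAlgebra E) {a b c : S} :
    S.restrict a b = some c ↔ oplus (a : E) (b : E) = some (c : E) := by
  unfold restrict
  split
  · rename_i h
    simp [h]
  · rename_i d h
    simp [h, Subtype.ext_iff]

/-- A sub-effect algebra is an effect algebra with the restricted operation and the same
`0` and `1`. -/
instance instEffectAlgebra (S : SubEffectAlgebra E) : EffectAlgebra S where
  zero := ⟨0, S.zero_mem⟩
  one := ⟨1, S.one_mem⟩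
  oplus := S.restrict
  oplus_comm a b c h := S.restrict_eq_some.2 (oplus_comm _ _ _ (S.restrict_eq_some.1 h))
  oplus_assoc a b c d e h1 h2 := by
    obtain ⟨f, hf, hf'⟩ :=
      oplus_assoc _ _ _ _ _ (S.restrict_eq_some.1 h1) (S.restrict_eq_some.1 h2)
    exact ⟨⟨f, S.oplus_mem b.2 c.2 hf⟩, S.restrict_eq_some.2 hf, S.restrict_eq_some.2 hf'⟩
  exists_unique_compl a :=
    ⟨⟨compl (a : E), S.ominus_mem 1 a _ S.one_mem a.2 (oplus_compl _)⟩,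
      S.restrict_eq_some.2 (oplus_compl _),
      fun _ hb => Subtype.ext (compl_unique (S.restrict_eq_some.1 hb) (oplus_compl _))⟩
  eq_zero_of_oplus_one a b h :=
    Subtype.ext (eq_zero_of_oplus_one _ _ (S.restrict_eq_some.1 h))

/-- A block of `E` is a maximal sub-effect algebra satisfying the Riesz decomposition
property. -/
def IsBlock (B : SubEffectAlgebra E) : Prop :=
  Maximal (fun S : SubEffectAlgebra E => RieszDecomposition S) B

end SubEffectAlgebra

/-! Riesz decomposition on an algebra containing `v₁`, `v₂`, `u` gives the instance of homogeneity
for these elements, and blocks come from Riesz sub-effect algebras by Zorn's lemma. The substance is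
that homogeneity puts every finite orthogonal family inside a Riesz sub-effect algebra.

Complete the family to a multiset `c` with sum `1` and refine it repeatedly, replacing each member
`x` by a multiset with sum `x` whose members, except at most one, are orthogonal to `x` (`Split`).
Homogeneity decomposes only elements orthogonal to the sum they lie under, and this kind of
splitting keeps that orthogonality available. Two splittings of the same element have a common
refinement (`IsHomogeneous.exists_common_refinement`), so iterated splitting is confluent by the
Church–Rosser theorem, and finitely many partial sums can be realised in one refinement.

If `b ≤ a` are partial sums of one refinement, their common part cancels. The remainders are sums of
disjoint parts, hence orthogonal, so homogeneity applies and a further splitting realises `b` inside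
`a` (`IsHomogeneous.exists_reach_le`). Thus the partial sums of all refinements of `c` are closed
under differences and satisfy Riesz decomposition. -/

namespace EffectAlgebra

/-! ### Cancellation, order, orthogonality and multiset sums. -/

section PartialSums

theorem toPartial_injective {E : Type u} : Function.Injective (toPartial : E → PartialValue E) :=
  fun _ _ h => Option.some.inj h

variable {E : Type u} [EffectAlgebra E]

theorem toPartial_add_eq {a b c : E} :
    toPartial a + toPartial b = toPartial c ↔ oplus a b = some c := Iff.rfl

theorem exists_of_add_eq_toPartial {x y : PartialValue E} {c : E} (h : x + y = toPartial c) :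
    ∃ a b : E, x = toPartial a ∧ y = toPartial b ∧ oplus a b = some c :=
  PartialValue.add_eq_some.1 h

/-- Both `b` and `c` are complements of `compl d ⊕ a`, and complements are unique. -/
theorem oplus_left_cancel {a b c d : E} (hb : oplus a b = some d) (hc : oplus a c = some d) :
    b = c := by
  have key : ∀ x : E, oplus a x = some d →
      ∃ f, oplus (compl d) a = some f ∧ oplus f x = some 1 := by
    intro x hx
    have h1 : toPartial (compl d) + toPartial a + toPartial x = toPartial (1 : E) := by
      rw [add_assoc, toPartial_add_eq.2 hx, add_comm]
      exact oplus_compl d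
    obtain ⟨f, y, hf, hy, h⟩ := exists_of_add_eq_toPartial h1
    rw [← toPartial_injective hy] at h
    exact ⟨f, hf, h⟩
  obtain ⟨f, hf, hfb⟩ := key b hb
  obtain ⟨g, hg, hgc⟩ := key c hc
  rw [hf] at hg
  cases hg
  exact compl_unique hfb hgc

/-- Definedness of the total is essential: the undefined value is absorbing and cannot be cancelled.
-/
theorem add_left_cancel_of_eq_toPartial {x y z : PartialValue E} {d : E}
    (hy : x + y = toPartial d) (hz : x + z = toPartial d) : y = z := by
  obtain ⟨a, b, rfl, rfl, h⟩ := exists_of_add_eq_toPartial hy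
  obtain ⟨a', c, ha, rfl, h'⟩ := exists_of_add_eq_toPartial hz
  rw [← toPartial_injective ha] at h'
  rw [oplus_left_cancel h h']

theorem Le.refl (a : E) : Le a a := ⟨0, oplus_zero a⟩

theorem le_left {a b c : E} (h : oplus a b = some c) : Le a c := ⟨b, h⟩

theorem le_right {a b c : E} (h : oplus a b = some c) : Le b c := ⟨a, oplus_comm _ _ _ h⟩

theorem Le.trans {a b c : E} (h₁ : Le a b) (h₂ : Le b c) : Le a c := by
  obtain ⟨x, hx⟩ := h₁
  obtain ⟨y, hy⟩ := h₂
  obtain ⟨f, -, hf⟩ := oplus_assoc _ _ _ _ _ hx hy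
  exact ⟨f, hf⟩

theorem eq_zero_of_le_zero {a : E} (h : Le a 0) : a = 0 := by
  obtain ⟨c, hc⟩ := h
  obtain ⟨f, hf, -⟩ := oplus_assoc _ _ _ _ _ (oplus_comm _ _ _ hc)
    (oplus_comm _ _ _ (oplus_zero (1 : E)))
  exact eq_zero_of_oplus_one a f hf

/-- `a` and `b` are orthogonal if `a ⊕ b` exists. -/
def Orth (a b : E) : Prop := ∃ c : E, oplus a b = some c

theorem Orth.symm {a b : E} (h : Orth a b) : Orth b a :=
  let ⟨c, hc⟩ := h
  ⟨c, oplus_comm _ _ _ hc⟩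

theorem Orth.mono_right {a b c : E} (h : Orth a c) (hb : Le b c) : Orth a b := by
  obtain ⟨x, hx⟩ := hb
  obtain ⟨s, hs⟩ := h
  have h1 : toPartial a + toPartial b + toPartial x = toPartial s := by
    rw [add_assoc, toPartial_add_eq.2 hx]
    exact hs
  obtain ⟨f, -, hf, -, -⟩ := exists_of_add_eq_toPartial h1
  exact ⟨f, hf⟩

theorem Orth.mono_left {a b c : E} (h : Orth c b) (ha : Le a c) : Orth a b :=
  (h.symm.mono_right ha).symm

theorem orth_iff_le_compl {a b : E} : Orth a b ↔ Le a (compl b) := by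
  constructor
  · rintro ⟨s, hs⟩
    obtain ⟨f, hf, hf'⟩ := oplus_assoc _ _ _ _ _ (oplus_comm _ _ _ hs) (oplus_compl s)
    exact ⟨_, compl_unique hf' (oplus_compl b) ▸ hf⟩
  · intro h
    exact Orth.mono_left ⟨1, oplus_comm _ _ _ (oplus_compl b)⟩ h

/-- The possibly undefined sum of a finite multiset of elements. -/
def msum (s : Multiset E) : PartialValue E := (s.map toPartial).sum

@[simp] theorem msum_zero : msum (0 : Multiset E) = toPartial 0 := rfl

@[simp] theorem msum_cons (a : E) (s : Multiset E) :
    msum (a ::ₘ s) = toPartial a + msum s := by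
  simp [msum]

@[simp] theorem msum_add (s t : Multiset E) : msum (s + t) = msum s + msum t := by
  simp [msum]

@[simp] theorem msum_singleton (a : E) : msum ({a} : Multiset E) = toPartial a := by
  simp [msum]

theorem exists_msum_of_le {s t : Multiset E} {w : E} (hst : s ≤ t) (ht : msum t = toPartial w) :
    ∃ a : E, msum s = toPartial a ∧ Le a w := by
  obtain ⟨r, rfl⟩ := Multiset.le_iff_exists_add.1 hst
  rw [msum_add] at ht
  obtain ⟨a, b, ha, -, h⟩ := exists_of_add_eq_toPartial ht
  exact ⟨a, ha, b, h⟩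

theorem le_of_mem_msum {s : Multiset E} {x w : E} (hx : x ∈ s) (hs : msum s = toPartial w) :
    Le x w := by
  obtain ⟨a, ha, h⟩ := exists_msum_of_le (Multiset.singleton_le.2 hx) hs
  rw [msum_singleton] at ha
  rwa [toPartial_injective ha]

theorem hasOSum_iff_msum {ι : Type*} {s : Finset ι} {c : ι → E} {a : E} :
    HasOSum s c a ↔ msum (s.val.map c) = toPartial a := by
  rw [HasOSum, msum, Multiset.map_map]
  rfl

end PartialSums

/-! ### Memberwise refinement of multisets. -/

section Refinement

/-- `d'` arises from `d` by replacing every member `x` by a multiset `e` with `r x e`. -/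
def Refines {α : Type*} (r : α → Multiset α → Prop) (d d' : Multiset α) : Prop :=
  ∃ D : Multiset (Multiset α), Multiset.Rel r d D ∧ D.join = d'

variable {α : Type*} {r r' : α → Multiset α → Prop}

/-- Take `I = A ∩ B`; what remains of `B` must fit into `C`. -/
theorem exists_common_part {A B C : Multiset α} (h : B ≤ A + C) :
    ∃ I A₁ B₁ C₁, A = I + A₁ ∧ B = I + B₁ ∧ C = B₁ + C₁ := by
  classical
  obtain ⟨C₁, hC₁⟩ := Multiset.le_iff_exists_add.1 (Multiset.sub_le_iff_le_add'.2 h)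
  refine ⟨A ∩ B, A - B, B - A, C₁, ?_, ?_, hC₁⟩
  · rw [add_comm, Multiset.sub_add_inter]
  · rw [Multiset.inter_comm, add_comm, Multiset.sub_add_inter]

theorem refines_zero : Refines r 0 0 := ⟨0, Multiset.Rel.zero, rfl⟩

theorem refines_zero_iff {d : Multiset α} : Refines r 0 d ↔ d = 0 := by
  constructor
  · rintro ⟨D, hD, rfl⟩
    rw [Multiset.rel_zero_left.1 hD]
    rfl
  · rintro rfl
    exact refines_zero

theorem Refines.add {a a' b b' : Multiset α} (ha : Refines r a a') (hb : Refines r b b') :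
    Refines r (a + b) (a' + b') := by
  obtain ⟨A, hA, rfl⟩ := ha
  obtain ⟨B, hB, rfl⟩ := hb
  exact ⟨A + B, hA.add hB, by simp⟩

theorem refines_add_iff {a b d : Multiset α} :
    Refines r (a + b) d ↔ ∃ a' b', Refines r a a' ∧ Refines r b b' ∧ d = a' + b' := by
  constructor
  · rintro ⟨D, hD, rfl⟩
    obtain ⟨A, B, hA, hB, rfl⟩ := Multiset.rel_add_left.1 hD
    exact ⟨_, _, ⟨A, hA, rfl⟩, ⟨B, hB, rfl⟩, by simp⟩
  · rintro ⟨a', b', ha, hb, rfl⟩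
    exact ha.add hb

theorem refines_singleton {x : α} {e : Multiset α} : Refines r {x} e ↔ r x e := by
  constructor
  · rintro ⟨D, hD, rfl⟩
    obtain ⟨e, D', he, hD', rfl⟩ := Multiset.rel_cons_left.1 hD
    obtain rfl := Multiset.rel_zero_left.1 hD'
    simpa using he
  · intro h
    exact ⟨{e}, Multiset.Rel.cons h Multiset.Rel.zero, by simp⟩

theorem Refines.cons {x : α} {e d d' : Multiset α} (h : r x e) (hd : Refines r d d') :
    Refines r (x ::ₘ d) (e + d') := by
  rw [← Multiset.singleton_add]
  exact (refines_singleton.2 h).add hd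

theorem refines_cons_iff {x : α} {d d' : Multiset α} :
    Refines r (x ::ₘ d) d' ↔ ∃ e f, r x e ∧ Refines r d f ∧ d' = e + f := by
  rw [← Multiset.singleton_add, refines_add_iff]
  simp only [refines_singleton]

theorem Refines.refl (h : ∀ x, r x {x}) (d : Multiset α) : Refines r d d := by
  induction d using Multiset.induction_on with
  | empty => exact refines_zero
  | cons x d ih => simpa using Refines.cons (h x) ih

theorem Refines.mono {d d' : Multiset α} (h : Refines r d d')
    (hr : ∀ x ∈ d, ∀ e, r x e → r' x e) : Refines r' d d' := by
  obtain ⟨D, hD, rfl⟩ := h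
  exact ⟨D, hD.mono fun x hx e _ => hr x hx e, rfl⟩

theorem Refines.diamond
    (h : ∀ x e f, r x e → r x f → ∃ g, Refines r e g ∧ Refines r f g)
    {d e f : Multiset α} (he : Refines r d e) (hf : Refines r d f) :
    ∃ g, Refines r e g ∧ Refines r f g := by
  induction d using Multiset.induction_on generalizing e f with
  | empty =>
    rw [refines_zero_iff] at he hf
    subst he hf
    exact ⟨0, refines_zero, refines_zero⟩
  | cons x d ih =>
    obtain ⟨e₁, e₂, he₁, he₂, rfl⟩ := refines_cons_iff.1 he
    obtain ⟨f₁, f₂, hf₁, hf₂, rfl⟩ := refines_cons_iff.1 hf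
    obtain ⟨g₁, h₁, h₁'⟩ := h x e₁ f₁ he₁ hf₁
    obtain ⟨g₂, h₂, h₂'⟩ := ih he₂ hf₂
    exact ⟨g₁ + g₂, h₁.add h₂, h₁'.add h₂'⟩

end Refinement

/-! ### Splittings, their confluence, and nesting of partial sums. -/

section Splitting

variable {E : Type u} [EffectAlgebra E]

/-- `e` has sum `x`, and all members of `e` except at most one are orthogonal to `q`. -/
def SplitAt (q x : E) (e : Multiset E) : Prop :=
  msum e = toPartial x ∧ ∃ (y : E) (t : Multiset E), e = y ::ₘ t ∧ ∀ z ∈ t, Orth z q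

/-- `e` has sum `x`, and all members of `e` except at most one are orthogonal to `x`. -/
def Split (x : E) (e : Multiset E) : Prop := SplitAt x x e

theorem SplitAt.self (q x : E) : SplitAt q x {x} :=
  ⟨msum_singleton x, x, 0, rfl, by simp⟩

theorem SplitAt.mono {p q x : E} {e : Multiset E} (h : SplitAt q x e) (hpq : Le p q) :
    SplitAt p x e := by
  obtain ⟨hs, y, t, he, ht⟩ := h
  exact ⟨hs, y, t, he, fun z hz => (ht z hz).mono_right hpq⟩

theorem Refines.msum_eq {q : E → E} {d d' : Multiset E}
    (h : Refines (fun x e => SplitAt (q x) x e) d d') : msum d' = msum d := by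
  induction d using Multiset.induction_on generalizing d' with
  | empty => rw [refines_zero_iff.1 h]
  | cons x d ih =>
    obtain ⟨e, f, he, hf, rfl⟩ := refines_cons_iff.1 h
    rw [msum_add, msum_cons, he.1, ih hf]

/-- The members of the first multiset are the sums `a ⊕ b` of matching members `a`, `b` of the
other two. -/
inductive PairwiseSum : Multiset E → Multiset E → Multiset E → Prop
  | zero : PairwiseSum 0 0 0
  | cons {x a b : E} {X A B : Multiset E} : oplus a b = some x → PairwiseSum X A B →
      PairwiseSum (x ::ₘ X) (a ::ₘ A) (b ::ₘ B)

theorem PairwiseSum.msum_eq {X A B : Multiset E} (h : PairwiseSum X A B) :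
    msum X = msum A + msum B := by
  induction h with
  | zero => exact (add_zero (0 : PartialValue E)).symm
  | cons hab _ ih =>
    simp only [msum_cons]
    rw [ih, ← toPartial_add_eq.2 hab]
    exact add_add_add_comm _ _ _ _

theorem PairwiseSum.symm {X A B : Multiset E} (h : PairwiseSum X A B) : PairwiseSum X B A := by
  induction h with
  | zero => exact .zero
  | cons hab _ ih => exact .cons (oplus_comm _ _ _ hab) ih

theorem PairwiseSum.orth {q : E} {X A B : Multiset E} (h : PairwiseSum X A B)
    (hX : ∀ x ∈ X, Orth x q) : ∀ a ∈ A, Orth a q := by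
  induction h with
  | zero => simp
  | cons hab _ ih =>
    rw [Multiset.forall_mem_cons] at hX ⊢
    exact ⟨hX.1.mono_left (le_left hab), ih hX.2⟩

/-- If `x = a ⊕ b`, adjoining `a` to a splitting of `b` splits `x`: since `a` is orthogonal to `q`,
the one exceptional member is still that of `b`. -/
theorem PairwiseSum.refines {q : E} {X A B g : Multiset E} (h : PairwiseSum X A B)
    (hA : ∀ a ∈ A, Orth a q) (hB : Refines (SplitAt q) B g) :
    Refines (SplitAt q) X (A + g) := by
  induction h generalizing g with
  | zero => rw [refines_zero_iff.1 hB]; exact refines_zero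
  | @cons x a b X A B hab _ ih =>
    rw [Multiset.forall_mem_cons] at hA
    obtain ⟨e, f, ⟨hs, y, t, rfl, ht⟩, hf, rfl⟩ := refines_cons_iff.1 hB
    have h1 : SplitAt q x (a ::ₘ (y ::ₘ t)) := by
      refine ⟨by rw [msum_cons, hs]; exact hab, y, a ::ₘ t, Multiset.cons_swap _ _ _, ?_⟩
      rw [Multiset.forall_mem_cons]
      exact ⟨hA.1, ht⟩
    have h2 := Refines.cons h1 (ih hA.2 hf)
    convert h2 using 1
    simp only [← Multiset.singleton_add]
    abel

theorem IsHomogeneous.exists_decomposition (hE : IsHomogeneous E) {u v₁ v₂ w : E}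
    (hw : oplus v₁ v₂ = some w) (hu : Le u w) (huw : Orth u w) :
    ∃ u₁ u₂ : E, Le u₁ v₁ ∧ Le u₂ v₂ ∧ oplus u₁ u₂ = some u :=
  hE u v₁ v₂ w hw hu (orth_iff_le_compl.1 huw)

/-- Homogeneity can be iterated along `X` because orthogonality of `u` and `w` passes down to the
remainders `u₂ ≤ u` and `w₁ ≤ w`. -/
theorem IsHomogeneous.exists_pairwiseSum (hE : IsHomogeneous E) {X : Multiset E} {u w : E}
    (hX : msum X = toPartial w) (hu : Le u w) (huw : Orth u w) :
    ∃ A B, PairwiseSum X A B ∧ msum A = toPartial u := by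
  induction X using Multiset.induction_on generalizing u w with
  | empty =>
    rw [msum_zero] at hX
    have h0 := toPartial_injective hX
    subst h0
    obtain rfl := eq_zero_of_le_zero hu
    exact ⟨0, 0, .zero, rfl⟩
  | cons x X ih =>
    rw [msum_cons] at hX
    obtain ⟨a, w₁, ha, hw₁, h⟩ := exists_of_add_eq_toPartial hX
    rw [← toPartial_injective ha] at h
    obtain ⟨u₁, u₂, ⟨b, hb⟩, hu₂, hu₁₂⟩ := hE.exists_decomposition h hu huw
    obtain ⟨A, B, hAB, hA⟩ := ih hw₁ hu₂
      ((huw.mono_left (le_right hu₁₂)).mono_right (le_right h))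
    exact ⟨u₁ ::ₘ A, b ::ₘ B, .cons hb hAB, by rw [msum_cons, hA]; exact hu₁₂⟩

/-- Each `y₁` in `t` is orthogonal to `q ≥ w`, so homogeneity cuts the `x`-row into a row `A` with
sum `y₁` and a row `B` with the sum of the other `y`'s, to which induction applies. Pieces of `A`
lie below `y₁` and pieces of the tail of `B` below members of `xs`, so the needed orthogonality to
`q` survives. -/
theorem IsHomogeneous.exists_common_refinement (hE : IsHomogeneous E) {q : E}
    (t xs : Multiset E) (x₀ y₀ w : E) (hw : Le w q)
    (hx : msum (x₀ ::ₘ xs) = toPartial w) (hy : msum (y₀ ::ₘ t) = toPartial w)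
    (hxs : ∀ x ∈ xs, Orth x q) (ht : ∀ y ∈ t, Orth y q) :
    ∃ g, Refines (SplitAt q) (x₀ ::ₘ xs) g ∧ Refines (SplitAt q) (y₀ ::ₘ t) g := by
  induction t using Multiset.induction_on generalizing xs x₀ w with
  | empty =>
    refine ⟨x₀ ::ₘ xs, Refines.refl (SplitAt.self q) _, ?_⟩
    rw [Multiset.cons_zero, refines_singleton]
    rw [Multiset.cons_zero, msum_singleton] at hy
    exact ⟨hx.trans hy.symm, x₀, xs, rfl, hxs⟩
  | cons y₁ t ih =>
    rw [Multiset.forall_mem_cons] at ht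
    rw [Multiset.cons_swap, msum_cons] at hy
    obtain ⟨y₁', w₂, hy₁', hw₂, hyw⟩ := exists_of_add_eq_toPartial hy
    rw [← toPartial_injective hy₁'] at hyw
    have hxw := hx
    rw [msum_cons] at hxw
    obtain ⟨x₀', w₁, hx₀', hw₁, hxw⟩ := exists_of_add_eq_toPartial hxw
    rw [← toPartial_injective hx₀'] at hxw
    have hy₁w : Orth y₁ w := ht.1.mono_right hw
    obtain ⟨a₀, a₁, ⟨b₀, hb₀⟩, ha₁, ha⟩ := hE.exists_decomposition hxw (le_left hyw) hy₁w
    obtain ⟨A, B, hAB, hA⟩ := hE.exists_pairwiseSum hw₁ ha₁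
      ((hy₁w.mono_left (le_right ha)).mono_right (le_right hxw))
    have hcut : PairwiseSum (x₀ ::ₘ xs) (a₀ ::ₘ A) (b₀ ::ₘ B) := .cons hb₀ hAB
    have hsA : msum (a₀ ::ₘ A) = toPartial y₁ := by
      rw [msum_cons, hA]
      exact ha
    have hsB : msum (b₀ ::ₘ B) = msum (y₀ ::ₘ t) := by
      refine add_left_cancel_of_eq_toPartial (x := toPartial y₁) (d := w) ?_ hy
      rw [← hsA, ← hcut.msum_eq, hx]
    -- The total shrinks from `w` to `w₂` while the bound `q` stays fixed; this is why the two are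
    -- kept separate.
    obtain ⟨g, hg₁, hg₂⟩ := ih B b₀ w₂ ((le_right hyw).trans hw) (hsB.trans hw₂) hw₂
      (hAB.symm.orth hxs) ht.2
    refine ⟨(a₀ ::ₘ A) + g, hcut.refines (fun a h => ?_) hg₁, ?_⟩
    · exact ht.1.mono_left (le_of_mem_msum h hsA)
    · rw [Multiset.cons_swap]
      exact Refines.cons ⟨hsA, a₀, A, rfl, hAB.orth hxs⟩ hg₂

theorem IsHomogeneous.split_diamond (hE : IsHomogeneous E) {x : E} {e f : Multiset E}
    (he : Split x e) (hf : Split x f) : ∃ g, Refines Split e g ∧ Refines Split f g := by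
  obtain ⟨hes, y, s, rfl, hs⟩ := he
  obtain ⟨hfs, z, t, rfl, ht⟩ := hf
  -- Use `q = x`: orthogonality to `x` implies orthogonality to every member, since members lie
  -- below `x`.
  obtain ⟨g, h₁, h₂⟩ := hE.exists_common_refinement t s y z x (Le.refl x) hes hfs hs ht
  exact ⟨g, h₁.mono fun a ha _ h => SplitAt.mono h (le_of_mem_msum ha hes),
    h₂.mono fun a ha _ h => SplitAt.mono h (le_of_mem_msum ha hfs)⟩

/-- `d'` arises from `d` by finitely many rounds of splitting. -/
def Reach : Multiset E → Multiset E → Prop := Relation.ReflTransGen (Refines Split)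

theorem Refines.split_refl (d : Multiset E) : Refines Split d d :=
  Refines.refl (fun x => SplitAt.self x x) d

theorem Reach.msum_eq {d d' : Multiset E} (h : Reach d d') : msum d' = msum d := by
  induction h with
  | refl => rfl
  | tail _ h ih => exact (Refines.msum_eq (q := id) h).trans ih

theorem Reach.add {a a' b b' : Multiset E} (ha : Reach a a') (hb : Reach b b') :
    Reach (a + b) (a' + b') := by
  have h₁ : Reach (a + b) (a' + b) :=
    Relation.ReflTransGen.lift (· + b) (fun _ _ h => Refines.add h (Refines.split_refl b)) _ _ ha
  have h₂ : Reach (a' + b) (a' + b') :=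
    Relation.ReflTransGen.lift (a' + ·) (fun _ _ h => (Refines.split_refl a').add h) _ _ hb
  exact Relation.ReflTransGen.trans h₁ h₂

theorem Reach.exists_of_add {a b d : Multiset E} (h : Reach (a + b) d) :
    ∃ a' b', Reach a a' ∧ Reach b b' ∧ d = a' + b' := by
  induction h with
  | refl => exact ⟨a, b, .refl, .refl, rfl⟩
  | tail _ h ih =>
    obtain ⟨a', b', ha, hb, rfl⟩ := ih
    obtain ⟨a'', b'', ha', hb', rfl⟩ := refines_add_iff.1 h
    exact ⟨a'', b'', ha.tail ha', hb.tail hb', rfl⟩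

theorem Reach.exists_le {A d d' : Multiset E} (h : Reach d d') (hA : A ≤ d) :
    ∃ A' ≤ d', msum A' = msum A := by
  obtain ⟨D, rfl⟩ := Multiset.le_iff_exists_add.1 hA
  obtain ⟨A', C, hA', -, rfl⟩ := h.exists_of_add
  exact ⟨A', Multiset.le_add_right _ _, hA'.msum_eq⟩

theorem IsHomogeneous.reach_confluent (hE : IsHomogeneous E) {c d e : Multiset E}
    (hd : Reach c d) (he : Reach c e) : ∃ f, Reach d f ∧ Reach e f :=
  Relation.church_rosser (fun _ _ _ h₁ h₂ =>
    let ⟨g, hg₁, hg₂⟩ := Refines.diamond (fun _ _ _ => hE.split_diamond) h₁ h₂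
    ⟨g, .single hg₁, .single hg₂⟩) hd he

/-- After cancelling the common part, `u ≤ v` and `u` is orthogonal to `v`, so `u` distributes over
`A₁`. The resulting pieces lie below `u`, so they are orthogonal to the members they are cut from,
and the cut is a legal splitting. -/
theorem IsHomogeneous.exists_reach_le (hE : IsHomogeneous E) {A B C : Multiset E} {a b s : E}
    (hs : msum (A + C) = toPartial s) (hB : B ≤ A + C) (hA : msum A = toPartial a)
    (hb : msum B = toPartial b) (hba : Le b a) :
    ∃ A', Reach A A' ∧ ∃ B' ≤ A', msum B' = toPartial b := by
  obtain ⟨I, A₁, B₁, C₁, rfl, rfl, rfl⟩ := exists_common_part hB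
  obtain ⟨v, hv, -⟩ := exists_msum_of_le (Multiset.le_add_left A₁ I) hA
  obtain ⟨u, hu, -⟩ := exists_msum_of_le (Multiset.le_add_left B₁ I) hb
  have huv : Le u v := by
    obtain ⟨z, hz⟩ := hba
    refine ⟨z, ?_⟩
    rw [msum_add] at hA hb
    change toPartial u + toPartial z = toPartial v
    rw [← hu, ← hv]
    refine add_left_cancel_of_eq_toPartial (x := msum I) (d := a) ?_ hA
    rw [← add_assoc, hb]
    exact hz
  -- `A₁` and `B₁` are disjoint parts of the orthogonal multiset `A + C`.
  have horth : Orth u v := by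
    have h : B₁ + A₁ ≤ I + A₁ + (B₁ + C₁) := by
      have : I + A₁ + (B₁ + C₁) = (B₁ + A₁) + (I + C₁) := by abel
      rw [this]
      exact Multiset.le_add_right _ _
    obtain ⟨c, hc, -⟩ := exists_msum_of_le h hs
    rw [msum_add, hu, hv] at hc
    exact ⟨c, hc⟩
  obtain ⟨P, Q, hPQ, hP⟩ := hE.exists_pairwiseSum hv huv horth
  have hsplit : Refines Split A₁ (P + Q) := by
    have h : Refines (SplitAt v) A₁ (P + Q) :=
      hPQ.refines (fun p hp => horth.mono_left (le_of_mem_msum hp hP))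
        (Refines.refl (SplitAt.self v) Q)
    exact h.mono fun x hx e he => SplitAt.mono he (le_of_mem_msum hx hv)
  refine ⟨I + (P + Q), Relation.ReflTransGen.single ((Refines.split_refl I).add hsplit),
    I + P, ?_, ?_⟩
  · rw [← add_assoc]
    exact Multiset.le_add_right _ _
  · rw [msum_add, hP, ← hu, ← msum_add, hb]

end Splitting

/-! ### The sub-effect algebra of partial sums of refinements. -/

section PartialSumAlgebra

variable {E : Type u} [EffectAlgebra E]

/-- The elements that are sums of submultisets of multisets reachable from `c`. -/
def reachableSums (c : Multiset E) : Set E :=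
  {a | ∃ d, Reach c d ∧ ∃ A ≤ d, msum A = toPartial a}

/-- By confluence, any reachable multiset can be refined further until it also exhibits `a`. -/
theorem IsHomogeneous.exists_reach_of_mem (hE : IsHomogeneous E) {c d : Multiset E} {a : E}
    (hd : Reach c d) (ha : a ∈ reachableSums c) :
    ∃ e, Reach d e ∧ ∃ A ≤ e, msum A = toPartial a := by
  obtain ⟨d', hd', A, hA, hs⟩ := ha
  obtain ⟨e, he, he'⟩ := hE.reach_confluent hd hd'
  obtain ⟨A', hA', hs'⟩ := he'.exists_le hA
  exact ⟨e, he, A', hA', hs'.trans hs⟩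

/-- If `a ⊕ b = w` in `reachableSums c`, then `a` and `b` are sums of complementary parts of a
part of a reachable multiset. -/
theorem IsHomogeneous.exists_reach_oplus (hE : IsHomogeneous E) {c : Multiset E} {s a b w : E}
    (hc : msum c = toPartial s) (ha : a ∈ reachableSums c) (hw : w ∈ reachableSums c)
    (h : oplus a b = some w) :
    ∃ A B C, Reach c (A + B + C) ∧ msum A = toPartial a ∧ msum B = toPartial b := by
  obtain ⟨d, hd, W, hW, hsW⟩ := hw
  obtain ⟨e, he, A, hA, hsA⟩ := hE.exists_reach_of_mem hd ha
  obtain ⟨W', hW', hsW'⟩ := he.exists_le hW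
  obtain ⟨C, rfl⟩ := Multiset.le_iff_exists_add.1 hW'
  have hce : Reach c (W' + C) := Relation.ReflTransGen.trans hd he
  obtain ⟨W'', hr, A', hA', hsA'⟩ := hE.exists_reach_le (hce.msum_eq.trans hc) hA
    (hsW'.trans hsW) hsA (le_left h)
  obtain ⟨B, rfl⟩ := Multiset.le_iff_exists_add.1 hA'
  refine ⟨A', B, C, Relation.ReflTransGen.trans hce (hr.add .refl), hsA', ?_⟩
  refine add_left_cancel_of_eq_toPartial (x := toPartial a) (d := w) ?_ h
  rw [← hsA', ← msum_add, hr.msum_eq, hsW', hsW]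

/-- The sub-effect algebra of sums of parts of multisets reachable from `c`. -/
def IsHomogeneous.reachableSubalgebra (hE : IsHomogeneous E) (c : Multiset E)
    (hc : msum c = toPartial (1 : E)) : SubEffectAlgebra E where
  carrier := reachableSums c
  one_mem := ⟨c, .refl, c, le_rfl, hc⟩
  ominus_mem a b x ha hb h := by
    obtain ⟨A, B, C, hr, -, hB⟩ := hE.exists_reach_oplus hc hb ha h
    refine ⟨_, hr, B, ?_, hB⟩
    rw [add_right_comm]
    exact Multiset.le_add_left _ _

end PartialSumAlgebra

/-! ### Reduction of Riesz decomposition to two summands. -/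

section RieszDecomposition

theorem rieszDecomposition_of_binary {E : Type u} [EffectAlgebra E]
    (h : ∀ u v₁ v₂ w : E, oplus v₁ v₂ = some w → Le u w →
      ∃ u₁ u₂ : E, Le u₁ v₁ ∧ Le u₂ v₂ ∧ oplus u₁ u₂ = some u) : RieszDecomposition E := by
  intro n
  induction n with
  | zero =>
    intro v w u hw hu
    obtain rfl : (0 : E) = w := toPartial_injective hw
    obtain rfl := eq_zero_of_le_zero hu
    exact ⟨v, fun i => i.elim0, rfl⟩
  | succ n ih =>
    intro v w u hw hu
    rw [HasOSum, Fin.sum_univ_succ] at hw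
    obtain ⟨a, w₁, ha, hw₁, haw⟩ := exists_of_add_eq_toPartial hw
    rw [← toPartial_injective ha] at haw
    obtain ⟨u₁, u₂, h₁, h₂, hu⟩ := h u _ _ w haw hu
    obtain ⟨t, ht, hs⟩ := ih _ w₁ u₂ hw₁ h₂
    refine ⟨Fin.cons u₁ t, Fin.cases h₁ ht, ?_⟩
    rw [HasOSum, Fin.sum_univ_succ]
    simp only [Fin.cons_zero, Fin.cons_succ]
    rw [show _ = _ from hs]
    exact hu

theorem RieszDecomposition.binary {E : Type u} [EffectAlgebra E] (h : RieszDecomposition E)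
    {u v₁ v₂ w : E} (hw : oplus v₁ v₂ = some w) (hu : Le u w) :
    ∃ u₁ u₂ : E, Le u₁ v₁ ∧ Le u₂ v₂ ∧ oplus u₁ u₂ = some u := by
  obtain ⟨t, ht, hs⟩ := h 2 ![v₁, v₂] w u (by rw [HasOSum, Fin.sum_univ_two]; exact hw) hu
  rw [HasOSum, Fin.sum_univ_two] at hs
  exact ⟨t 0, t 1, ht 0, ht 1, hs⟩

end RieszDecomposition

end EffectAlgebra

/-! ### Riesz sub-effect algebras and existence of blocks. -/

namespace SubEffectAlgebra

open EffectAlgebra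

variable {E : Type u} [EffectAlgebra E]

theorem le_coe_iff (S : SubEffectAlgebra E) {a b : S} : Le a b ↔ Le (a : E) (b : E) := by
  constructor
  · rintro ⟨c, hc⟩
    exact ⟨c, S.restrict_eq_some.1 hc⟩
  · rintro ⟨c, hc⟩
    exact ⟨⟨c, S.ominus_mem b a c b.2 a.2 hc⟩, S.restrict_eq_some.2 hc⟩

theorem rieszDecomposition_iff (S : SubEffectAlgebra E) :
    RieszDecomposition S ↔ ∀ u ∈ S, ∀ v₁ ∈ S, ∀ v₂ ∈ S, ∀ w ∈ S, oplus v₁ v₂ = some w →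
      Le u w → ∃ u₁ ∈ S, ∃ u₂ ∈ S, Le u₁ v₁ ∧ Le u₂ v₂ ∧ oplus u₁ u₂ = some u := by
  constructor
  · intro h u hu v₁ hv₁ v₂ hv₂ w hw hvw huw
    obtain ⟨u₁, u₂, h₁, h₂, hs⟩ := h.binary (u := ⟨u, hu⟩) (v₁ := ⟨v₁, hv₁⟩) (v₂ := ⟨v₂, hv₂⟩)
      (w := ⟨w, hw⟩) (S.restrict_eq_some.2 hvw) (S.le_coe_iff.2 huw)
    exact ⟨u₁, u₁.2, u₂, u₂.2, S.le_coe_iff.1 h₁, S.le_coe_iff.1 h₂, S.restrict_eq_some.1 hs⟩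
  · intro h
    refine rieszDecomposition_of_binary fun u v₁ v₂ w hvw huw => ?_
    obtain ⟨u₁, m₁, u₂, m₂, h₁, h₂, hs⟩ := h u u.2 v₁ v₁.2 v₂ v₂.2 w w.2
      (S.restrict_eq_some.1 hvw) (S.le_coe_iff.1 huw)
    exact ⟨⟨u₁, m₁⟩, ⟨u₂, m₂⟩, S.le_coe_iff.2 h₁, S.le_coe_iff.2 h₂, S.restrict_eq_some.2 hs⟩

/-- The union of a nonempty chain of sub-effect algebras. -/
def chainUnion (C : Set (SubEffectAlgebra E)) (hC : IsChain (· ≤ ·) C) (hne : C.Nonempty) :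
    SubEffectAlgebra E where
  carrier := {a | ∃ S ∈ C, a ∈ S}
  one_mem := let ⟨S, hS⟩ := hne; ⟨S, hS, S.one_mem⟩
  ominus_mem := by
    rintro a b c ⟨S, hS, ha⟩ ⟨T, hT, hb⟩ h
    obtain ⟨U, hU, hSU, hTU⟩ := hC.directedOn S hS T hT
    exact ⟨U, hU, U.ominus_mem a b c (hSU ha) (hTU hb) h⟩

/-- Each instance of the binary property involves finitely many elements, which already lie in one
member of the chain. -/
theorem rieszDecomposition_chainUnion (C : Set (SubEffectAlgebra E)) (hC : IsChain (· ≤ ·) C)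
    (hne : C.Nonempty) (h : ∀ S ∈ C, RieszDecomposition S) :
    RieszDecomposition (chainUnion C hC hne) := by
  rw [rieszDecomposition_iff]
  rintro u ⟨S, hS, hu⟩ v₁ ⟨S₁, hS₁, hv₁⟩ v₂ ⟨S₂, hS₂, hv₂⟩ w - hvw huw
  obtain ⟨T, hT, h₁, h₂⟩ := hC.directedOn S₁ hS₁ S₂ hS₂
  obtain ⟨U, hU, hTU, hSU⟩ := hC.directedOn T hT S hS
  have m₁ : v₁ ∈ U := hTU (h₁ hv₁)
  have m₂ : v₂ ∈ U := hTU (h₂ hv₂)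
  obtain ⟨u₁, k₁, u₂, k₂, hr⟩ := U.rieszDecomposition_iff.1 (h U hU) u (hSU hu) v₁ m₁ v₂ m₂ w
    (U.oplus_mem m₁ m₂ hvw) hvw huw
  exact ⟨u₁, ⟨U, hU, k₁⟩, u₂, ⟨U, hU, k₂⟩, hr⟩

theorem exists_isBlock_ge (S : SubEffectAlgebra E) (hS : RieszDecomposition S) :
    ∃ B : SubEffectAlgebra E, B.IsBlock ∧ S ≤ B := by
  obtain ⟨B, hSB, hB⟩ := zorn_le_nonempty₀ {S : SubEffectAlgebra E | RieszDecomposition S}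
    (fun C hCs hC T hT => ⟨chainUnion C hC ⟨T, hT⟩,
      rieszDecomposition_chainUnion C hC ⟨T, hT⟩ hCs, fun U hU _ ha => ⟨U, hU, ha⟩⟩) S hS
  exact ⟨B, hB, hSB⟩

end SubEffectAlgebra

/-! ### Riesz decomposition for partial sums, and the equivalences. -/

namespace EffectAlgebra

variable {E : Type u} [EffectAlgebra E]

/-- Realise `v₁`, `v₂` by disjoint parts, and refine until `u` is the sum of a part `U'` of their
union. Intersecting `U'` with the part for `v₁` gives `u₁`; the rest lies in the part for `v₂` and
gives `u₂`. -/
theorem IsHomogeneous.rieszDecomposition_reachableSubalgebra (hE : IsHomogeneous E)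
    (c : Multiset E) (hc : msum c = toPartial (1 : E)) :
    RieszDecomposition (hE.reachableSubalgebra c hc) := by
  rw [SubEffectAlgebra.rieszDecomposition_iff]
  intro u hu v₁ hv₁ v₂ hv₂ w hw hvw huw
  obtain ⟨A, B, C, hr, hA, hB⟩ := hE.exists_reach_oplus hc hv₁ hw hvw
  obtain ⟨d, hd, U, hU, hsU⟩ := hE.exists_reach_of_mem hr hu
  obtain ⟨_, C', hAB, hC, rfl⟩ := hd.exists_of_add
  obtain ⟨A', B', hA', hB', rfl⟩ := hAB.exists_of_add
  have hrd := Relation.ReflTransGen.trans hr hd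
  have hs : msum (A' + B') = toPartial w := by
    rw [msum_add, hA'.msum_eq, hB'.msum_eq, hA, hB]
    exact hvw
  obtain ⟨_, hAB', U', hU', hsU'⟩ := hE.exists_reach_le ((Reach.msum_eq hrd).trans hc) hU hs hsU huw
  obtain ⟨X, Y, hX, hY, rfl⟩ := hAB'.exists_of_add
  have hre : Reach c (X + Y + C') := Relation.ReflTransGen.trans hrd (hAB'.add .refl)
  obtain ⟨I, X₁, U₁, Y₁, rfl, rfl, rfl⟩ := exists_common_part hU'
  rw [msum_add] at hsU'
  obtain ⟨u₁, u₂, h₁, h₂, hu₁₂⟩ := exists_of_add_eq_toPartial hsU'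
  obtain ⟨a, ha, hle₁⟩ := exists_msum_of_le (Multiset.le_add_right I X₁)
    (hX.msum_eq.trans (hA'.msum_eq.trans hA))
  obtain ⟨b, hb, hle₂⟩ := exists_msum_of_le (Multiset.le_add_right U₁ Y₁)
    (hY.msum_eq.trans (hB'.msum_eq.trans hB))
  rw [h₁] at ha
  rw [h₂] at hb
  rw [← toPartial_injective ha] at hle₁
  rw [← toPartial_injective hb] at hle₂
  refine ⟨u₁, ⟨_, hre, I, ?_, h₁⟩, u₂, ⟨_, hre, U₁, ?_, h₂⟩, hle₁, hle₂, hu₁₂⟩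
  · rw [add_assoc, add_assoc]
    exact Multiset.le_add_right _ _
  · rw [add_assoc, add_assoc U₁, add_left_comm]
    exact Multiset.le_add_right _ _

theorem IsHomogeneous.exists_rieszDecomposition_of_isOrthogonal (hE : IsHomogeneous E) {n : ℕ}
    {c : Fin n → E} (hc : IsOrthogonal c) :
    ∃ R : SubEffectAlgebra E, RieszDecomposition R ∧
      ∀ (A : Finset (Fin n)) (a : E), HasOSum A c a → a ∈ R := by
  obtain ⟨s, hs⟩ := hc
  rw [hasOSum_iff_msum] at hs
  -- Adjoining `compl s` makes the total `1`, so that `1` is itself a partial sum.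
  have h1 : msum (compl s ::ₘ (Finset.univ.val.map c)) = toPartial (1 : E) := by
    rw [msum_cons, hs, add_comm]
    exact oplus_compl s
  refine ⟨hE.reachableSubalgebra _ h1, hE.rieszDecomposition_reachableSubalgebra _ h1,
    fun A a ha => ⟨_, .refl, A.val.map c, ?_, hasOSum_iff_msum.1 ha⟩⟩
  exact (Multiset.map_le_map (Finset.val_le_iff.2 A.subset_univ)).trans (Multiset.le_cons_self _ _)

theorem isCompatible_range {n : ℕ} {c : Fin n → E} (hc : IsOrthogonal c) :
    IsCompatible (Set.range c) := by
  refine fun F hF => ⟨n, c, hc, Set.subset_univ _, fun a ha => ?_⟩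
  obtain ⟨i, rfl⟩ := hF ha
  exact ⟨{i}, Finset.sum_singleton _ _⟩

theorem IsHomogeneous.exists_rieszDecomposition_of_isCompatible (hE : IsHomogeneous E)
    {M : Set E} (hM : M.Finite) (hc : IsCompatible M) :
    ∃ R : SubEffectAlgebra E, RieszDecomposition R ∧ M ⊆ (R : Set E) := by
  obtain ⟨n, c, ho, -, h⟩ := hc hM.toFinset (by simp)
  obtain ⟨R, hR, hmem⟩ := hE.exists_rieszDecomposition_of_isOrthogonal ho
  refine ⟨R, hR, fun a ha => ?_⟩
  obtain ⟨A, hA⟩ := h a (hM.mem_toFinset.2 ha)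
  exact hmem A a hA

theorem isHomogeneous_of_orthogonal_triples
    (h : ∀ c : Fin 3 → E, IsOrthogonal c →
      ∃ R : SubEffectAlgebra E, RieszDecomposition R ∧ Set.range c ⊆ (R : Set E)) :
    IsHomogeneous E := by
  intro u v₁ v₂ w hw hu huw
  -- The hypothesis `u ≤ w'` says exactly that `(v₁, v₂, u)` is orthogonal.
  obtain ⟨s, hs⟩ := (orth_iff_le_compl.2 huw).symm
  obtain ⟨R, hR, hc⟩ := h ![v₁, v₂, u] ⟨s, by
    rw [HasOSum, Fin.sum_univ_three]
    change toPartial v₁ + toPartial v₂ + toPartial u = toPartial s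
    rw [toPartial_add_eq.2 hw]
    exact hs⟩
  have m₁ : v₁ ∈ R := hc ⟨0, rfl⟩
  have m₂ : v₂ ∈ R := hc ⟨1, rfl⟩
  have m₃ : u ∈ R := hc ⟨2, rfl⟩
  obtain ⟨u₁, -, u₂, -, hr⟩ := R.rieszDecomposition_iff.1 hR u m₃ v₁ m₁ v₂ m₂ w
    (R.oplus_mem m₁ m₂ hw) hw hu
  exact ⟨u₁, u₂, hr⟩

end EffectAlgebra

theorem mainTheorem10 (E : Type u) [EffectAlgebra E] :
    List.TFAE [
      EffectAlgebra.IsHomogeneous E,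
      ∀ M : Set E, M.Finite → EffectAlgebra.IsCompatible M →
        ∃ B : SubEffectAlgebra E, B.IsBlock ∧ M ⊆ (B : Set E),
      ∀ M : Set E, M.Finite → EffectAlgebra.IsCompatible M →
        ∃ R : SubEffectAlgebra E, EffectAlgebra.RieszDecomposition R ∧ M ⊆ (R : Set E),
      ∀ (n : ℕ) (c : Fin n → E), EffectAlgebra.IsOrthogonal c →
        ∃ B : SubEffectAlgebra E, B.IsBlock ∧ Set.range c ⊆ (B : Set E),
      ∀ (n : ℕ) (c : Fin n → E), EffectAlgebra.IsOrthogonal c →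
        ∃ R : SubEffectAlgebra E, EffectAlgebra.RieszDecomposition R ∧
          Set.range c ⊆ (R : Set E),
      ∀ c : Fin 3 → E, EffectAlgebra.IsOrthogonal c →
        ∃ B : SubEffectAlgebra E, B.IsBlock ∧ Set.range c ⊆ (B : Set E),
      ∀ c : Fin 3 → E, EffectAlgebra.IsOrthogonal c →
        ∃ R : SubEffectAlgebra E, EffectAlgebra.RieszDecomposition R ∧
          Set.range c ⊆ (R : Set E)] := by
  tfae_have 1 → 3 := fun hE _ => hE.exists_rieszDecomposition_of_isCompatible
  tfae_have 3 → 2 := fun h M hM hc =>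
    let ⟨R, hR, hMR⟩ := h M hM hc
    let ⟨B, hB, hRB⟩ := R.exists_isBlock_ge hR
    ⟨B, hB, hMR.trans hRB⟩
  tfae_have 2 → 4 := fun h _ _ hc =>
    h _ (Set.finite_range _) (EffectAlgebra.isCompatible_range hc)
  tfae_have 4 → 5 := fun h n c hc =>
    let ⟨B, hB, hcB⟩ := h n c hc
    ⟨B, hB.1, hcB⟩
  tfae_have 4 → 6 := fun h => h 3
  tfae_have 6 → 7 := fun h c hc =>
    let ⟨B, hB, hcB⟩ := h c hc
    ⟨B, hB.1, hcB⟩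
  tfae_have 5 → 7 := fun h => h 3
  tfae_have 7 → 1 := EffectAlgebra.isHomogeneous_of_orthogonal_triples
  tfae_finish
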